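/- Write $\omega^*=\beta\omega\setminus\omega$ for the remainder of the Čech–Stone compactification of the discrete space $\omega$ of natural numbers, and $c_0$ for the Banach space of real sequences converging to $0$. The weight of a topological space is the least cardinality of a base, and its density is the least cardinality of a dense subset. For real Banach spaces $Y,Z$, the notation $\mathrm{Ext}(Z,Y)=0$ means that for every short exact sequence $0\to Y\xrightarrow{\,i\,} X\xrightarrow{\,q\,} Z\to 0$ of real Banach spaces and bounded linear operators, $i$ admits a bounded linear left inverse. (1) If $K$ is a compact Hausdorff space of weight $\omega_1$, then there are at least $2^{\omega_1}$ continuous maps $\omega^*\to K$. (2) If $Y$ is a real Banach space of density $\omega_1$ and its dual $Y^*$ (the space of all bounded linear functionals on $Y$) has cardinality $|Y^*|<2^{\omega_1}$, then $\mathrm{Ext}(Y,c_0)\neq 0$. -/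

import Mathlib

open scoped Cardinal ZeroAtInfty

universe u v

noncomputable section

/-- The weight of a topological space: the least cardinality of a base of its topology. -/
def topWeight (X : Type u) [TopologicalSpace X] : Cardinal.{u} :=
  sInf {κ : Cardinal.{u} |
    ∃ B : Set (Set X), TopologicalSpace.IsTopologicalBasis B ∧ Cardinal.mk B = κ}

/-- The density of a topological space: the least cardinality of a dense subset. -/
def topDensity (X : Type u) [TopologicalSpace X] : Cardinal.{u} :=
  sInf {κ : Cardinal.{u} | ∃ D : Set X, Dense D ∧ Cardinal.mk D = κ}

/-- The remainder of the Stone–Čech compactification of the discrete space of natural numbers,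
with the subspace topology. -/
abbrev OmegaStar : Type :=
  {p : StoneCech ℕ // p ∉ Set.range (stoneCechUnit : ℕ → StoneCech ℕ)}

/-- `0 ⟶ Y ⟶ X ⟶ Z ⟶ 0` is a short exact sequence, with maps `i` and `q`. -/
structure IsTwistedSum {Y X Z : Type*}
    [NormedAddCommGroup Y] [NormedSpace ℝ Y]
    [NormedAddCommGroup X] [NormedSpace ℝ X]
    [NormedAddCommGroup Z] [NormedSpace ℝ Z]
    (i : Y →L[ℝ] X) (q : X →L[ℝ] Z) : Prop where
  injective : Function.Injective i
  exact : Function.Exact i q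
  surjective : Function.Surjective q

/-- `Ext(Z, Y) = 0`: every twisted sum `0 ⟶ Y ⟶ X ⟶ Z ⟶ 0` with `X` a Banach space is trivial,
that is, the map `Y ⟶ X` has a bounded linear left inverse. The middle space of such a sequence is
in bijection with `Y × Z`, so every twisted sum is isomorphic to one in the universe
`max u v`. -/
def ExtVanishes (Z : Type u) (Y : Type v)
    [NormedAddCommGroup Z] [NormedSpace ℝ Z]
    [NormedAddCommGroup Y] [NormedSpace ℝ Y] : Prop :=
  ∀ (X : Type (max u v)) [NormedAddCommGroup X] [NormedSpace ℝ X] [CompleteSpace X]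
    (i : Y →L[ℝ] X) (q : X →L[ℝ] Z), IsTwistedSum i q →
      ∃ r : X →L[ℝ] Y, r.comp i = ContinuousLinearMap.id ℝ Y

end

/-! Part (1). Separate the points of K by ℵ₁ real functions φ i, indexed so that every initial
segment is countable. The values of (φ j) for j < i then form a metrizable compact image of K. A
surjection from ω* onto that image lifts to the image with coordinate φ i added: extend it to βω by
Tietze, replace the values on ω by nearby points of K, and extend again. The lift can be altered on
an infinite subset of ω, which makes it surjective and gives two different lifts whenever φ i is not
determined by the earlier coordinates (`exists_two_extensions`). Limit stages hold by compactness.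
The levels that branch already separate points, so there are uncountably many of them, and the
branches give 2^ℵ₁ maps (`two_power_aleph_one_le_mk_continuousMap`).

Part (2). The same count applies to maps f from ω* to the weak-star dual ball of Y. Each f gives an
operator from Y to C(ω*), along which 0 → c₀ → C(βω) → C(ω*) → 0 is pulled back. If the pullback
splits, the operator lifts to C(βω), and the lift is a sequence in Y*. Hence 2^ℵ₁ ≤ |Y*|^ℵ₀, and
|Y*|^ℵ₀ = |Y*| because Y* is a Banach space (`mk_power_aleph0_eq_of_banach`). -/

section

open Set Filter Topology

/-! ### Points of ω* as limits along infinite subsets of ω -/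

section StoneCechNat

theorem isOpen_singleton_stoneCechUnit (n : ℕ) :
    IsOpen ({stoneCechUnit n} : Set (StoneCech ℕ)) := by
  classical
  have hg : Continuous (fun m : ℕ => decide (m = n)) := continuous_of_discreteTopology
  have hU : IsOpen (stoneCechExtend hg ⁻¹' {true}) :=
    (isOpen_discrete _).preimage (continuous_stoneCechExtend hg)
  convert hU
  refine Subset.antisymm ?_ ?_
  · rintro _ rfl
    simp [stoneCechExtend_stoneCechUnit]
  · intro p hp
    have := denseRange_stoneCechUnit.open_subset_closure_inter hU hp
    refine closure_minimal ?_ isClosed_singleton this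
    rintro _ ⟨h, m, rfl⟩
    simp [stoneCechExtend_stoneCechUnit] at h
    simp [h]

theorem stoneCechUnit_nat_injective : Function.Injective (stoneCechUnit : ℕ → StoneCech ℕ) := by
  classical
  intro m n h
  have hg : Continuous (fun k : ℕ => decide (k = n)) := continuous_of_discreteTopology
  have := congrArg (stoneCechExtend hg) h
  simpa [stoneCechExtend_stoneCechUnit] using this

theorem isClosed_compl_range_stoneCechUnit :
    IsClosed {p : StoneCech ℕ | p ∉ range (stoneCechUnit : ℕ → StoneCech ℕ)} := by
  have : IsOpen (range (stoneCechUnit : ℕ → StoneCech ℕ)) := by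
    rw [← iUnion_singleton_eq_range]
    exact isOpen_iUnion isOpen_singleton_stoneCechUnit
  exact this.isClosed_compl

instance compactSpace_omegaStar : CompactSpace OmegaStar :=
  isCompact_iff_compactSpace.mp isClosed_compl_range_stoneCechUnit.isCompact

theorem isClosedEmbedding_omegaStar :
    IsClosedEmbedding (Subtype.val : OmegaStar → StoneCech ℕ) :=
  isClosed_compl_range_stoneCechUnit.isClosedEmbedding_subtypeVal

/-- By compactness of βω the cofinite filter on S has a cluster point, and an isolated point n
cannot be one. -/
theorem Set.Infinite.exists_omegaStar_frequently {S : Set ℕ} (hS : S.Infinite) :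
    ∃ p : OmegaStar, ∃ᶠ n in comap stoneCechUnit (𝓝 p.1), n ∈ S := by
  have : NeBot (cofinite ⊓ 𝓟 S) := cofinite_inf_principal_neBot_iff.mpr hS
  obtain ⟨p, hp⟩ := exists_clusterPt_of_compactSpace (map (stoneCechUnit : ℕ → StoneCech ℕ)
    (cofinite ⊓ 𝓟 S))
  have hp' : NeBot (comap stoneCechUnit (𝓝 p) ⊓ (cofinite ⊓ 𝓟 S)) := by
    have : NeBot (𝓝 p ⊓ map (stoneCechUnit : ℕ → StoneCech ℕ) (cofinite ⊓ 𝓟 S)) := hp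
    rw [← Filter.push_pull'] at this
    exact this.of_map
  refine ⟨⟨p, ?_⟩, ?_⟩
  · rintro ⟨n, rfl⟩
    have h1 : ∀ᶠ m in comap stoneCechUnit (𝓝 (stoneCechUnit n : StoneCech ℕ)), m = n :=
      (eventually_of_mem (preimage_mem_comap
        ((isOpen_singleton_stoneCechUnit n).mem_nhds rfl))
        fun m hm => stoneCechUnit_nat_injective hm)
    have h2 : ∀ᶠ m in cofinite ⊓ 𝓟 S, m ≠ n :=
      (eventually_cofinite_ne n).filter_mono inf_le_left
    obtain ⟨m, h, h'⟩ := ((h1.filter_mono inf_le_left).and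
      (h2.filter_mono (inf_le_right (a := comap stoneCechUnit (𝓝 (stoneCechUnit n))))))
        |>.exists
    exact h' h
  · rw [frequently_mem_iff_neBot]
    exact hp'.mono (inf_le_inf_left _ inf_le_right)

instance nonempty_omegaStar : Nonempty OmegaStar :=
  let ⟨p, _⟩ := infinite_univ.exists_omegaStar_frequently
  ⟨p⟩

instance neBot_comap_stoneCechUnit (p : StoneCech ℕ) :
    NeBot (comap (stoneCechUnit : ℕ → StoneCech ℕ) (𝓝 p)) :=
  comap_neBot fun _ ht => (denseRange_stoneCechUnit.exists_mem_open isOpen_interior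
    ⟨p, mem_interior_iff_mem_nhds.mpr ht⟩).imp fun _ h => interior_subset h

theorem comap_stoneCechUnit_le_cofinite (p : OmegaStar) :
    comap (stoneCechUnit : ℕ → StoneCech ℕ) (𝓝 p.1) ≤ cofinite := by
  rw [le_cofinite_iff_compl_singleton_mem]
  intro n
  refine ⟨{stoneCechUnit n}ᶜ, isClosed_singleton.isOpen_compl.mem_nhds ?_, ?_⟩
  · rintro h
    exact p.2 ⟨n, h.symm⟩
  · intro m hm h
    exact hm (congrArg stoneCechUnit h)

theorem eventually_cofinite_of_omegaStar {P : ℕ → Prop}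
    (h : ∀ p : OmegaStar, ∀ᶠ n in comap stoneCechUnit (𝓝 p.1), P n) : ∀ᶠ n in cofinite, P n := by
  by_contra hP
  obtain ⟨p, hp⟩ := Set.Infinite.exists_omegaStar_frequently (S := {n | ¬ P n}) hP
  exact hp (by simpa using h p)

theorem ContinuousMap.tendsto_comap_stoneCechUnit {E : Type*} [TopologicalSpace E]
    (f : C(StoneCech ℕ, E)) (p : StoneCech ℕ) :
    Tendsto (fun n => f (stoneCechUnit n)) (comap stoneCechUnit (𝓝 p)) (𝓝 (f p)) :=
  (f.continuous.tendsto p).comp tendsto_comap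

end StoneCechNat

/-! ### Lifting maps on ω* through metrizable images -/

section Lifting

variable {K : Type u} [TopologicalSpace K] [CompactSpace K] [T2Space K]

/-- On ω* only the asymptotic behaviour of a sequence matters, so any points of K whose images
approach a Tietze extension of h give a lift. The subsequence n depends on t only through Φ ∘ t, so
one n serves all sequences in the same fibres; this lets two lifts be compared at a single point. -/
theorem exists_asymptotic_lift {E : Type v} [MetricSpace E] [TietzeExtension.{0, v} E]
    (Φ : C(K, E)) (h : C(OmegaStar, E)) (hr : range h = range Φ) (t : ℕ → K) :
    ∃ n : ℕ → ℕ, StrictMono n ∧ ∀ t' : ℕ → K, (∀ m, Φ (t' m) = Φ (t m)) →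
      ∃ X : C(StoneCech ℕ, K), (∀ p : OmegaStar, Φ (X p.1) = h p) ∧
        ∀ m, X (stoneCechUnit (n m)) = t' m := by
  classical
  obtain ⟨H, hH⟩ := ContinuousMap.exists_extension' isClosedEmbedding_omegaStar h
  have hH' : ∀ p : OmegaStar, H p.1 = h p := fun p => congrFun hH p
  have hne : (range Φ).Nonempty := hr ▸ range_nonempty h
  have hcomp : IsCompact (range Φ) := isCompact_range Φ.continuous
  set a : ℕ → E := fun n => H (stoneCechUnit n) with ha
  have hta : ∀ p : OmegaStar, Tendsto a (comap stoneCechUnit (𝓝 p.1)) (𝓝 (h p)) := fun p => by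
    rw [← hH' p]
    exact H.tendsto_comap_stoneCechUnit p.1
  have hk : ∀ n, ∃ k : K, Metric.infDist (a n) (range Φ) = dist (a n) (Φ k) := fun n => by
    obtain ⟨_, ⟨k, rfl⟩, hk⟩ := hcomp.exists_infDist_eq_dist hne (a n)
    exact ⟨k, hk⟩
  choose k hk using hk
  have hk0 : ∀ ε > 0, ∀ᶠ n in cofinite, dist (a n) (Φ (k n)) < ε := by
    intro ε hε
    refine eventually_cofinite_of_omegaStar fun p => ?_
    filter_upwards [Metric.tendsto_nhds.mp (hta p) ε hε] with n hn
    rw [← hk n]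
    have hm : h p ∈ range Φ := hr ▸ mem_range_self p
    exact (Metric.infDist_le_dist_of_mem hm).trans_lt hn
  -- Surjectivity of h onto the image enters here: Φ (t m) is a value of h, hence a limit of a along
  -- a filter finer than the cofinite one.
  have hfreq : ∀ m : ℕ, ∃ᶠ n in atTop, dist (a n) (Φ (t m)) < 1 / ((m : ℝ) + 1) := by
    intro m
    have : Φ (t m) ∈ range h := hr ▸ mem_range_self _
    obtain ⟨p, hp⟩ := this
    rw [← Nat.cofinite_eq_atTop, ← hp]
    exact ((Metric.tendsto_nhds.mp (hta p) _ Nat.one_div_pos_of_nat).frequently).filter_mono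
      (comap_stoneCechUnit_le_cofinite p)
  obtain ⟨n, hn, hnd⟩ := extraction_forall_of_frequently hfreq
  refine ⟨n, hn, fun t' ht' => ?_⟩
  set x : ℕ → K := Function.extend n t' k with hx
  have hxn : ∀ m, x (n m) = t' m := fun m => hn.injective.extend_apply _ _ _
  have hx0 : ∀ ε > 0, ∀ᶠ i in cofinite, dist (a i) (Φ (x i)) < ε := by
    intro ε hε
    obtain ⟨N, hN⟩ := exists_nat_one_div_lt hε
    filter_upwards [hk0 ε hε, (Set.finite_lt_nat (n N)).compl_mem_cofinite] with i hi hiN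
    by_cases him : ∃ m, n m = i
    · obtain ⟨m, rfl⟩ := him
      rw [hxn, ht']
      have hm : N ≤ m := by
        by_contra hlt
        exact hiN (hn (not_le.mp hlt))
      refine (hnd m).trans (lt_of_le_of_lt ?_ hN)
      exact Nat.one_div_le_one_div hm
    · rwa [hx, Function.extend_apply' _ _ _ him]
  have hxc : Continuous x := continuous_of_discreteTopology
  let X : C(StoneCech ℕ, K) := ⟨stoneCechExtend hxc, continuous_stoneCechExtend hxc⟩
  have hX : ∀ i, X (stoneCechUnit i) = x i := fun i => stoneCechExtend_stoneCechUnit hxc i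
  refine ⟨X, fun p => ?_, fun m => by rw [hX, hxn]⟩
  have h1 := (Φ.comp X).tendsto_comap_stoneCechUnit p.1
  have h2 : Tendsto (fun i => dist (a i) (Φ (x i))) (comap stoneCechUnit (𝓝 p.1)) (𝓝 0) := by
    refine Metric.tendsto_nhds.mpr fun ε hε => ?_
    filter_upwards [comap_stoneCechUnit_le_cofinite p (hx0 ε hε)] with i hi
    simpa using hi
  have h3 : Tendsto (fun i => dist (a i) (Φ (x i))) (comap stoneCechUnit (𝓝 p.1))
      (𝓝 (dist (h p) (Φ (X p.1)))) := by
    refine (hta p).dist ?_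
    simpa [hX] using h1
  exact (dist_eq_zero.mp (tendsto_nhds_unique h3 h2)).symm

/-- A point prescribed infinitely often along the subsequence is a value of the lift on ω*.
Prescribing a dense sequence in this way yields surjectivity, since the image is closed; prescribing
two points of one Φ-fibre yields two lifts. -/
theorem exists_two_extensions {E : Type v} [MetricSpace E] [SecondCountableTopology E]
    [TietzeExtension.{0, v} E] (Φ : C(K, E)) (ψ : C(K, ℝ)) (h : C(OmegaStar, E))
    (hr : range h = range Φ) :
    ∃ g : Bool → C(OmegaStar, ℝ),
      (∀ b, range (fun p => (h p, g b p)) = range (fun x => (Φ x, ψ x))) ∧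
      ((∃ x y, Φ x = Φ y ∧ ψ x ≠ ψ y) → g true ≠ g false) := by
  classical
  obtain ⟨z, hz⟩ : ∃ z : Bool → K, Φ (z true) = Φ (z false) ∧
      ((∃ x y, Φ x = Φ y ∧ ψ x ≠ ψ y) → ψ (z true) ≠ ψ (z false)) := by
    by_cases hxy : ∃ x y, Φ x = Φ y ∧ ψ x ≠ ψ y
    · obtain ⟨x, y, h1, h2⟩ := hxy
      exact ⟨fun b => if b then x else y, by simpa using h1, fun _ => by simpa using h2⟩
    · obtain ⟨p⟩ := nonempty_omegaStar
      have : h p ∈ range Φ := hr ▸ mem_range_self p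
      obtain ⟨x, -⟩ := this
      exact ⟨fun _ => x, rfl, fun h => absurd h hxy⟩
  let f : K → E × ℝ := fun x => (Φ x, ψ x)
  have hf : Continuous f := by fun_prop
  have : Nonempty (range f) := ⟨⟨f (z true), mem_range_self _⟩⟩
  obtain ⟨k, hk⟩ : ∃ k : ℕ → K, ∀ m, f (k m) = TopologicalSpace.denseSeq (range f) m :=
    ⟨fun m => (TopologicalSpace.denseSeq (range f) m).2.choose,
      fun m => (TopologicalSpace.denseSeq (range f) m).2.choose_spec⟩
  -- Even positions carry the point that distinguishes the two lifts; odd positions visit each `k j`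
  -- infinitely often through the pairing function.
  let t : Bool → ℕ → K := fun b m => if Even m then z b else k (m / 2).unpair.1
  have htΦ : ∀ b m, Φ (t b m) = Φ (t true m) := by
    intro b m
    cases b
    · by_cases hm : Even m
      · simp [t, hm, hz.1]
      · simp [t, hm]
    · rfl
  obtain ⟨n, hn, hX⟩ := exists_asymptotic_lift Φ h hr (t true)
  choose X hX1 hX2 using fun b => hX (t b) (htΦ b)
  let g : Bool → C(OmegaStar, ℝ) := fun b => ψ.comp ((X b).comp ⟨_, continuous_subtype_val⟩)
  have hg : ∀ b p, g b p = ψ (X b p.1) := fun b p => rfl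
  -- The point p depends on M alone, so it serves both values of b.
  have key : ∀ M : Set ℕ, M.Infinite → ∃ p : OmegaStar, ∀ b x, (∀ m ∈ M, t b m = x) →
      X b p.1 = x := by
    intro M hM
    obtain ⟨p, hp⟩ := (hM.image hn.injective.injOn).exists_omegaStar_frequently
    refine ⟨p, fun b x hx => ?_⟩
    have h1 := (X b).tendsto_comap_stoneCechUnit p.1
    by_contra hne
    have h2 := h1.eventually_ne hne
    obtain ⟨_, ⟨m, hm, rfl⟩, h3⟩ := (hp.and_eventually h2).exists
    exact h3 (by rw [hX2, hx m hm])
  refine ⟨g, fun b => ?_, fun hxy => ?_⟩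
  · refine Subset.antisymm ?_ ?_
    · rintro _ ⟨p, rfl⟩
      exact ⟨X b p.1, by simp [hX1, hg]⟩
    · have hcl : IsClosed (range (fun p => (h p, g b p))) :=
        (isCompact_range (by fun_prop)).isClosed
      have hsub : ∀ m, f (k m) ∈ range (fun p => (h p, g b p)) := by
        intro m
        have hM : (range fun i : ℕ => 2 * Nat.pair m i + 1).Infinite :=
          infinite_range_of_injective fun i j hij => by
            have : Nat.pair m i = Nat.pair m j := by simpa using hij
            simpa using this
        obtain ⟨p, hp⟩ := key _ hM
        have := hp b (k m) (by
          rintro _ ⟨i, rfl⟩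
          have h1 : ¬ Even (2 * Nat.pair m i + 1) := by simp
          have h2 : (2 * Nat.pair m i + 1) / 2 = Nat.pair m i := by omega
          simp only [t, if_neg h1, h2, Nat.unpair_pair])
        exact ⟨p, by simp [f, ← hX1 b, hg, this]⟩
      rintro _ ⟨x, rfl⟩
      let y : range f := ⟨f x, mem_range_self x⟩
      have hy : y ∈ closure (range (TopologicalSpace.denseSeq (range f))) :=
        TopologicalSpace.denseRange_denseSeq _ y
      have hy' := image_closure_subset_closure_image continuous_subtype_val
        (mem_image_of_mem Subtype.val hy)
      refine closure_minimal ?_ hcl hy'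
      rintro _ ⟨_, ⟨m, rfl⟩, rfl⟩
      rw [← hk]
      exact hsub m
  · have hM : (range fun i : ℕ => 2 * i).Infinite :=
      infinite_range_of_injective fun i j hij => by simpa using hij
    obtain ⟨p, hp⟩ := key _ hM
    have hz' : ∀ b, X b p.1 = z b := fun b => hp b (z b) (by
      rintro _ ⟨i, rfl⟩
      simp [t])
    intro heq
    apply hz.2 hxy
    rw [← hz' true, ← hz' false, ← hg, ← hg, heq]

end Lifting

/-! ### Transfinite recursion along the coordinates -/

section Recursion

/-- The solution sets of the initial segments are a decreasing family of nonempty compact sets. This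
is the limit step, used both for points of K and for points of ω*. -/
theorem exists_forall_mem_eq_of_forall_Iic {X I : Type*} [TopologicalSpace X] [CompactSpace X]
    [Nonempty X] [LinearOrder I] (A : Set I) (f g : I → X → ℝ) (hf : ∀ i, Continuous (f i))
    (hg : ∀ i, Continuous (g i)) (h : ∀ i ∈ A, ∃ x, ∀ j ≤ i, f j x = g j x) :
    ∃ x, ∀ i ∈ A, f i x = g i x := by
  rcases A.eq_empty_or_nonempty with rfl | hA
  · exact ⟨Classical.arbitrary X, by simp⟩
  have : Nonempty A := hA.to_subtype
  let C : A → Set X := fun i => {x | ∀ j ≤ i.1, f j x = g j x}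
  have hC : ∀ i, IsClosed (C i) := fun i => by
    simp only [C, ofPred_forall]
    exact isClosed_iInter fun j => isClosed_iInter fun _ => isClosed_eq (hf j) (hg j)
  have hanti : Antitone C := fun i j hij x hx k hk => hx k (hk.trans hij)
  obtain ⟨x, hx⟩ := IsCompact.nonempty_iInter_of_directed_nonempty_isCompact_isClosed C
    hanti.directed_ge (fun i => h i.1 i.2) (fun i => (hC i).isCompact) hC
  exact ⟨x, fun i hi => mem_iInter.mp hx ⟨i, hi⟩ i le_rfl⟩

variable {K : Type u} [TopologicalSpace K]

/-- The coordinates `h i`, for `i ∈ A`, define a continuous map from `OmegaStar` onto the image of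
`K` under the map with coordinates `φ i`, for `i ∈ A`. -/
def CoordinatesOnto {I : Type v} (φ : I → C(K, ℝ)) (A : Set I) (h : I → C(OmegaStar, ℝ)) : Prop :=
  (∀ p, ∃ x, ∀ i ∈ A, φ i x = h i p) ∧ ∀ x, ∃ p, ∀ i ∈ A, φ i x = h i p

theorem CoordinatesOnto.congr {I : Type v} {φ : I → C(K, ℝ)} {A : Set I}
    {h h' : I → C(OmegaStar, ℝ)} (H : CoordinatesOnto φ A h) (hh : ∀ i ∈ A, h i = h' i) :
    CoordinatesOnto φ A h' :=
  ⟨fun p => (H.1 p).imp fun _ hx i hi => hh i hi ▸ hx i hi,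
    fun x => (H.2 x).imp fun _ hx i hi => hh i hi ▸ hx i hi⟩

variable [CompactSpace K]

theorem coordinatesOnto_of_forall_Iic [Nonempty K] {I : Type v} [LinearOrder I] {φ : I → C(K, ℝ)}
    {A : Set I} {h : I → C(OmegaStar, ℝ)} (H : ∀ i ∈ A, CoordinatesOnto φ (Iic i) h) :
    CoordinatesOnto φ A h :=
  ⟨fun p => exists_forall_mem_eq_of_forall_Iic A (fun i x => φ i x) (fun i _ => h i p)
      (fun i => (φ i).continuous) (fun _ => continuous_const) fun i hi => (H i hi).1 p,
    fun x => exists_forall_mem_eq_of_forall_Iic A (fun i _ => φ i x) (fun i p => h i p)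
      (fun _ => continuous_const) (fun i => (h i).continuous) fun i hi => (H i hi).2 x⟩

/-- Countability of `Iio i` makes the product of the earlier coordinates metrizable, as the lifting
argument requires. -/
theorem CoordinatesOnto.exists_two_extensions [T2Space K] {I : Type v} [LinearOrder I]
    (φ : I → C(K, ℝ)) {i : I} (hi : (Iio i).Countable) {h : I → C(OmegaStar, ℝ)}
    (H : CoordinatesOnto φ (Iio i) h) :
    ∃ g : Bool → C(OmegaStar, ℝ),
      (∀ b h', (∀ j < i, h' j = h j) → h' i = g b → CoordinatesOnto φ (Iic i) h') ∧
      ((∃ x y, (∀ j < i, φ j x = φ j y) ∧ φ i x ≠ φ i y) → g true ≠ g false) := by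
  have : Countable (Iio i) := hi.to_subtype
  let _ : MetricSpace (Iio i → ℝ) := TopologicalSpace.metrizableSpaceMetric _
  let Φ : C(K, Iio i → ℝ) := ⟨fun x j => φ j.1 x, by fun_prop⟩
  let η : C(OmegaStar, Iio i → ℝ) := ⟨fun p j => h j.1 p, by fun_prop⟩
  have hr : range η = range Φ := by
    refine Subset.antisymm ?_ ?_
    · rintro _ ⟨p, rfl⟩
      obtain ⟨x, hx⟩ := H.1 p
      exact ⟨x, funext fun j => hx j.1 j.2⟩
    · rintro _ ⟨x, rfl⟩
      obtain ⟨p, hp⟩ := H.2 x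
      exact ⟨p, funext fun j => (hp j.1 j.2).symm⟩
  obtain ⟨g, hg, hne⟩ := _root_.exists_two_extensions Φ (φ i) η hr
  refine ⟨g, fun b h' hh hgi => ?_, ?_⟩
  · have aux : ∀ p x, ((η p, g b p) : (Iio i → ℝ) × ℝ) = (Φ x, φ i x) →
        ∀ j ∈ Iic i, φ j x = h' j p := by
      intro p x hpx j hj
      obtain ⟨h1, h2⟩ := Prod.mk.inj hpx
      rcases (mem_Iic.mp hj).lt_or_eq with hlt | rfl
      · rw [hh j hlt]
        exact (congrFun h1 ⟨j, hlt⟩).symm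
      · rw [hgi]
        exact h2.symm
    refine ⟨fun p => ?_, fun x => ?_⟩
    · have : (η p, g b p) ∈ range fun x => (Φ x, φ i x) := hg b ▸ mem_range_self p
      obtain ⟨x, hx⟩ := this
      exact ⟨x, aux p x hx.symm⟩
    · have : (Φ x, φ i x) ∈ range fun p => (η p, g b p) := hg b ▸ mem_range_self x
      obtain ⟨p, hp⟩ := this
      exact ⟨p, aux p x hp⟩
  · rintro ⟨x, y, h1, h2⟩
    exact hne ⟨x, y, funext fun j => h1 j.1 j.2, h2⟩

/-- A coherent binary tree of coordinate maps on `OmegaStar`, split at every level at which the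
new coordinate is not determined by the preceding ones. -/
theorem exists_coordinate_tree [T2Space K] [Nonempty K] {I : Type v} [LinearOrder I]
    [WellFoundedLT I] (hI : ∀ i : I, (Iio i).Countable) (φ : I → C(K, ℝ)) :
    ∃ g : (I → Bool) → I → C(OmegaStar, ℝ), (∀ s, CoordinatesOnto φ univ (g s)) ∧
      ∀ i, (∃ x y, (∀ j < i, φ j x = φ j y) ∧ φ i x ≠ φ i y) →
        ∀ s s', (∀ j < i, s j = s' j) → s i ≠ s' i → g s i ≠ g s' i := by
  classical
  -- The choice is made total, with junk value 0, so that the recursion can be defined before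
  -- surjectivity is known.
  have step : ∀ (i : I) (h : I → C(OmegaStar, ℝ)), ∃ g : Bool → C(OmegaStar, ℝ),
      CoordinatesOnto φ (Iio i) h →
      (∀ b h', (∀ j < i, h' j = h j) → h' i = g b → CoordinatesOnto φ (Iic i) h') ∧
      ((∃ x y, (∀ j < i, φ j x = φ j y) ∧ φ i x ≠ φ i y) → g true ≠ g false) := by
    intro i h
    by_cases H : CoordinatesOnto φ (Iio i) h
    · obtain ⟨g, hg⟩ := H.exists_two_extensions φ (hI i)
      exact ⟨g, fun _ => hg⟩
    · exact ⟨fun _ => 0, fun H' => absurd H' H⟩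
  choose G hG using step
  let F (s : I → Bool) (i : I) (f : ∀ j, j < i → C(OmegaStar, ℝ)) : C(OmegaStar, ℝ) :=
    G i (fun j => if hj : j < i then f j hj else 0) (s i)
  let g : (I → Bool) → I → C(OmegaStar, ℝ) := fun s => (wellFounded_lt (α := I)).fix (F s)
  -- Truncation by 0 makes the input at level i depend only on lower levels, so branches that agree
  -- below i feed `G` literally the same function.
  let r : (I → Bool) → I → I → C(OmegaStar, ℝ) := fun s i j => if j < i then g s j else 0
  have hg : ∀ s i, g s i = G i (r s i) (s i) := by
    intro s i
    change (wellFounded_lt (α := I)).fix (F s) i = _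
    rw [WellFounded.fix_eq]
    rfl
  have hr : ∀ s i, ∀ j < i, g s j = r s i j := fun s i j hj => (if_pos hj).symm
  have onto : ∀ s i, CoordinatesOnto φ (Iic i) (g s) := by
    intro s i
    induction i using WellFoundedLT.induction with
    | ind i ih =>
      have h1 : CoordinatesOnto φ (Iio i) (r s i) :=
        (coordinatesOnto_of_forall_Iic ih).congr (hr s i)
      exact (hG i _ h1).1 (s i) (g s) (hr s i) (hg s i)
  have coh : ∀ s s' i, (∀ j < i, s j = s' j) → r s i = r s' i := by
    intro s s' i
    induction i using WellFoundedLT.induction with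
    | ind i ih =>
      intro h
      funext j
      by_cases hj : j < i
      · rw [← hr s i j hj, ← hr s' i j hj, hg, hg, h j hj,
          ih j hj fun k hk => h k (hk.trans hj)]
      · simp [r, hj]
  refine ⟨g, fun s => coordinatesOnto_of_forall_Iic fun i _ => onto s i, ?_⟩
  intro i hi s s' hs hne
  have h1 : CoordinatesOnto φ (Iio i) (r s i) :=
    (coordinatesOnto_of_forall_Iic fun j _ => onto s j).congr (hr s i)
  have h2 := (hG i _ h1).2 hi
  rw [hg s, hg s', ← coh s s' i hs]
  cases h3 : s i <;> cases h4 : s' i <;> simp_all [Ne.symm]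

theorem CoordinatesOnto.exists_continuousMap [T2Space K] {I : Type v} {φ : I → C(K, ℝ)}
    (hsep : ∀ x y, (∀ i, φ i x = φ i y) → x = y) {h : I → C(OmegaStar, ℝ)}
    (H : CoordinatesOnto φ univ h) :
    ∃ f : C(OmegaStar, K), ∀ i p, φ i (f p) = h i p := by
  choose f hf using H.1
  have he : IsEmbedding (fun x i => φ i x : K → I → ℝ) :=
    (Continuous.isClosedEmbedding (by fun_prop) fun x y hxy =>
      hsep x y fun i => congrFun hxy i).isEmbedding
  refine ⟨⟨f, ?_⟩, fun i p => hf p i (mem_univ i)⟩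
  rw [he.continuous_iff]
  have : (fun x i => φ i x : K → I → ℝ) ∘ f = fun p i => h i p :=
    funext fun p => funext fun i => hf p i (mem_univ i)
  rw [this]
  fun_prop

/-- At a level that does not split, φ i is determined by the earlier coordinates. By induction the
splitting levels alone separate points, so they are uncountable. -/
theorem two_power_aleph_one_le_mk_continuousMap_of_wellOrder [T2Space K] {I : Type u}
    [LinearOrder I] [WellFoundedLT I] (hI : ∀ i : I, (Iio i).Countable) (φ : I → C(K, ℝ))
    (hsep : ∀ x y, (∀ i, φ i x = φ i y) → x = y)
    (hns : ∀ S : Set I, S.Countable → ∃ x y, x ≠ y ∧ ∀ i ∈ S, φ i x = φ i y) :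
    (2 : Cardinal.{u}) ^ (ℵ₁ : Cardinal.{u}) ≤ #C(OmegaStar, K) := by
  classical
  have : Nonempty K := let ⟨x, _⟩ := hns ∅ countable_empty; ⟨x⟩
  obtain ⟨g, hg, hne⟩ := exists_coordinate_tree hI φ
  choose f hf using fun s => (hg s).exists_continuousMap hsep
  let S : Set I := {i | ∃ x y, (∀ j < i, φ j x = φ j y) ∧ φ i x ≠ φ i y}
  have hS : ¬ S.Countable := by
    intro hS
    obtain ⟨x, y, hxy, h⟩ := hns S hS
    refine hxy (hsep x y fun i => ?_)
    induction i using WellFoundedLT.induction with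
    | ind i ih =>
      by_contra hi
      exact hi (h i ⟨x, y, ih, hi⟩)
  have hcard : (ℵ₁ : Cardinal.{u}) ≤ #S :=
    Cardinal.aleph_one_le_iff.mpr <| Cardinal.aleph0_lt_mk_iff.mpr ((not_countable_iff (α := S)).mp hS)
  -- Choices are free only on S, so two distinct ones first differ at a level that splits.
  let e : (S → Bool) → I → Bool := fun s i => if hi : i ∈ S then s ⟨i, hi⟩ else false
  have hinj : Function.Injective fun s : S → Bool => f (e s) := by
    intro s s' hss
    by_contra hne'
    have hT : {i : I | e s i ≠ e s' i}.Nonempty := by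
      obtain ⟨i, hi⟩ := Function.ne_iff.mp hne'
      exact ⟨i.1, by simpa [e] using hi⟩
    obtain ⟨i, hi, hmin⟩ := WellFounded.has_min (wellFounded_lt (α := I)) _ hT
    have hiS : i ∈ S := by
      by_contra hiS
      exact hi (by simp [e, hiS])
    refine hne i hiS (e s) (e s') (fun j hj => ?_) hi ?_
    · by_contra h
      exact hmin j h hj
    · ext p
      rw [← hf, ← hf]
      exact congrArg (fun F : C(OmegaStar, K) => φ i (F p)) hss
  calc (2 : Cardinal.{u}) ^ (ℵ₁ : Cardinal.{u}) ≤ 2 ^ #S :=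
        Cardinal.power_le_power_left two_ne_zero hcard
    _ = #(S → Bool) := by simp
    _ ≤ #C(OmegaStar, K) := Cardinal.mk_le_of_injective hinj

/-- If a family of `ℵ₁` continuous functions separates the points of a compact space, and no
countable subfamily does, then the space receives `2 ^ ℵ₁` continuous maps from `OmegaStar`. -/
theorem two_power_aleph_one_le_mk_continuousMap [T2Space K] {J : Type u} (hJ : #J = ℵ₁)
    (φ : J → C(K, ℝ)) (hsep : ∀ x y, (∀ i, φ i x = φ i y) → x = y)
    (hns : ∀ S : Set J, S.Countable → ∃ x y, x ≠ y ∧ ∀ i ∈ S, φ i x = φ i y) :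
    (2 : Cardinal.{u}) ^ (ℵ₁ : Cardinal.{u}) ≤ #C(OmegaStar, K) := by
  have h : #(ℵ₁ : Cardinal.{u}).ord.ToType = #J := by rw [Cardinal.mk_ord_toType, hJ]
  obtain ⟨e⟩ := Cardinal.eq.mp h
  refine two_power_aleph_one_le_mk_continuousMap_of_wellOrder
    (I := (ℵ₁ : Cardinal.{u}).ord.ToType)
    (fun i => Cardinal.le_aleph0_iff_set_countable.mp (Cardinal.lt_aleph_one_iff.mp
      (by simpa using Cardinal.mk_Iio_lt i (by simp))))
    (fun i => φ (e i)) (fun x y hxy => hsep x y fun j => ?_) fun S hS => ?_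
  · simpa using hxy (e.symm j)
  · obtain ⟨x, y, hxy, h⟩ := hns (e '' S) (hS.image e)
    exact ⟨x, y, hxy, fun i hi => h _ (mem_image_of_mem e hi)⟩

/-- Urysohn functions for pairs from a base of size ℵ₁ separate points. A countable separating
subfamily would embed K in a countable power of ℝ and make its weight countable. -/
theorem two_power_aleph_one_le_of_topWeight_eq [T2Space K] (hK : topWeight K = ℵ₁) :
    (2 : Cardinal.{u}) ^ (ℵ₁ : Cardinal.{u}) ≤ #C(OmegaStar, K) := by
  classical
  obtain ⟨B, hB, hBc⟩ : ∃ B : Set (Set K), TopologicalSpace.IsTopologicalBasis B ∧ #B = ℵ₁ := by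
    have h : topWeight K ∈ _ := csInf_mem
      ⟨_, _, TopologicalSpace.isTopologicalBasis_opens (α := K), rfl⟩
    rwa [hK] at h
  have hex : ∀ q : B × B, ∃ f : C(K, ℝ),
      closure q.1.1 ⊆ q.2.1 → EqOn f 0 (closure q.1.1) ∧ EqOn f 1 q.2.1ᶜ := by
    intro q
    by_cases hq : closure q.1.1 ⊆ q.2.1
    · obtain ⟨f, h0, h1, -⟩ := exists_continuous_zero_one_of_isClosed
        (isClosed_closure (s := q.1.1)) (hB.isOpen q.2.2).isClosed_compl
        (disjoint_compl_right_iff_subset.mpr hq)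
      exact ⟨f, fun _ => ⟨h0, h1⟩⟩
    · exact ⟨0, fun h => absurd h hq⟩
  choose φ hφ using hex
  refine two_power_aleph_one_le_mk_continuousMap (J := B × B) ?_ φ ?_ ?_
  · rw [← Cardinal.mul_def, hBc]
    exact Cardinal.mul_eq_self (Cardinal.aleph0_le_aleph 1)
  · intro x y hxy
    by_contra hne
    obtain ⟨V, hV, hxV, hVy⟩ := hB.mem_nhds_iff.mp (isOpen_ne.mem_nhds hne)
    obtain ⟨U, hU, hxU, hUV⟩ := hB.exists_closure_subset ((hB.isOpen hV).mem_nhds hxV)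
    obtain ⟨h0, h1⟩ := hφ (⟨U, hU⟩, ⟨V, hV⟩) hUV
    have := hxy (⟨U, hU⟩, ⟨V, hV⟩)
    rw [h0 (subset_closure hxU), h1 fun hy => hVy hy rfl] at this
    simp at this
  · intro S hS
    by_contra! hcon
    have : Countable S := hS.to_subtype
    have he : IsEmbedding (fun x i => φ i.1 x : K → S → ℝ) :=
      (Continuous.isClosedEmbedding (by fun_prop) fun x y hxy => by
        by_contra hne
        obtain ⟨i, hi, h⟩ := hcon x y hne
        exact h (congrFun hxy ⟨i, hi⟩)).isEmbedding
    have : SecondCountableTopology K := he.secondCountableTopology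
    have hle : topWeight K ≤ ℵ₀ :=
      (show topWeight K ≤ #(TopologicalSpace.countableBasis K) from
        csInf_le' ⟨_, TopologicalSpace.isBasis_countableBasis K, rfl⟩).trans
        (TopologicalSpace.countable_countableBasis K).le_aleph0
    rw [hK] at hle
    exact hle.not_gt Cardinal.aleph0_lt_aleph_one

end Recursion

/-! ### A Banach space Z satisfies |Z|^ℵ₀ = |Z| -/

section BanachCardinality

theorem exists_maximal_separated (Z : Type*) [NormedAddCommGroup Z] :
    ∃ D : Set Z, 0 ∈ D ∧ D.Pairwise (fun x y => 1 ≤ ‖x - y‖) ∧ ∀ z, ∃ d ∈ D, ‖z - d‖ < 1 := by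
  obtain ⟨D, h0, hD⟩ := zorn_subset_nonempty
    {D : Set Z | D.Pairwise (fun x y => 1 ≤ ‖x - y‖)}
    (fun c hc hchain _ => ⟨⋃₀ c, (pairwise_sUnion hchain.directedOn).mpr fun s hs => hc hs,
      fun s hs => subset_sUnion_of_mem hs⟩) {0} (pairwise_singleton _ _)
  refine ⟨D, h0 rfl, hD.prop, fun z => ?_⟩
  by_contra! hz
  have hins : (insert z D).Pairwise (fun x y => 1 ≤ ‖x - y‖) :=
    hD.prop.insert fun d hd _ => ⟨hz d hd, by rw [norm_sub_rev]; exact hz d hd⟩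
  have hzD : z ∈ D := hD.le_of_ge hins (subset_insert z D) (mem_insert z D)
  have := hz z hzD
  norm_num at this

/-- Weights decreasing so fast that a series `∑ c k • v k` of terms `v k` from a `1`-separated set
with `‖v k‖ ≤ k` determines the sequence `v`. -/
theorem exists_rapidly_decreasing :
    ∃ c : ℕ → ℝ, (∀ k, 0 < c k) ∧ (∀ k, k * c k ≤ (1 / 2) ^ k) ∧
      ∀ k m : ℕ, 2 * ((k + 1 + m : ℕ) * c (k + 1 + m)) ≤ c k / 4 * (1 / 2) ^ m := by
  -- The factorial absorbs the norm bound k on the terms; the factor 8 supplies the constants 2 and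
  -- 4.
  let c : ℕ → ℝ := fun k => (1 / 8) ^ k / (k + 1).factorial
  have hpos : ∀ k, 0 < c k := fun k => by positivity
  have hrec : ∀ k, c (k + 1) * (8 * (k + 2)) = c k := fun k => by
    simp only [c, Nat.factorial_succ (k + 1)]
    push_cast
    field_simp
    ring
  have hhalf : ∀ k, c (k + 1) ≤ c k * (1 / 2) := fun k => by
    have := hpos (k + 1)
    rw [← hrec k]
    have hk : (0 : ℝ) ≤ k := k.cast_nonneg
    nlinarith
  have hgeom : ∀ k m, c (k + m) ≤ c k * (1 / 2) ^ m := fun k m => by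
    induction m with
    | zero => simp
    | succ m ih =>
      calc c (k + m + 1) ≤ c (k + m) * (1 / 2) := hhalf _
        _ ≤ c k * (1 / 2) ^ m * (1 / 2) := by gcongr
        _ = _ := by ring
  have hstep : ∀ k m : ℕ, 2 * ((k + 1 + m : ℕ) * c (k + 1 + m)) ≤ c k / 4 * (1 / 2) ^ m := by
    intro k m
    have h1 : k + 1 + m = k + m + 1 := by omega
    have h2 := hrec (k + m)
    have h3 := hpos (k + m + 1)
    have h4 := hgeom k m
    rw [h1]
    push_cast at h2 ⊢
    nlinarith
  refine ⟨c, hpos, fun k => ?_, hstep⟩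
  rcases k with _ | k
  · simp
  · have h1 := hstep 0 k
    have h2 : c 0 = 1 := by simp [c]
    rw [h2, zero_add, add_comm 1 k] at h1
    rw [pow_succ]
    have : (0 : ℝ) < (1 / 2) ^ k := by positivity
    linarith

/-- At the first index k where two sequences differ, the difference of the terms has norm at least c
k, while the remaining tail contributes at most c k / 2. -/
theorem tsum_smul_injOn_separated {Z : Type*} [NormedAddCommGroup Z] [NormedSpace ℝ Z]
    [CompleteSpace Z] {D : Set Z} (hD : D.Pairwise (fun x y => 1 ≤ ‖x - y‖)) {c : ℕ → ℝ}
    (hpos : ∀ k, 0 < c k) (hsum : ∀ k, k * c k ≤ (1 / 2) ^ k)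
    (hc : ∀ k m : ℕ, 2 * ((k + 1 + m : ℕ) * c (k + 1 + m)) ≤ c k / 4 * (1 / 2) ^ m) :
    InjOn (fun v : ℕ → Z => ∑' k, c k • v k) {v | ∀ k, v k ∈ D ∧ ‖v k‖ ≤ k} := by
  classical
  intro v hv w hw hvw
  have hsm : ∀ v : ℕ → Z, (∀ k, v k ∈ D ∧ ‖v k‖ ≤ k) → Summable fun k => c k • v k := by
    intro v hv
    refine Summable.of_norm_bounded summable_geometric_two fun k => ?_
    rw [norm_smul, Real.norm_of_nonneg (hpos k).le, mul_comm]
    exact (mul_le_mul_of_nonneg_right (hv k).2 (hpos k).le).trans (hsum k)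
  by_contra hne
  have hex : ∃ k, v k ≠ w k := Function.ne_iff.mp hne
  let k := Nat.find hex
  have hk : v k ≠ w k := Nat.find_spec hex
  have hlt : ∀ j < k, v j = w j := fun j hj => not_not.mp (Nat.find_min hex hj)
  let d : ℕ → Z := fun j => c j • (v j - w j)
  have hds : Summable d := by
    simpa only [d, smul_sub] using (hsm v hv).sub (hsm w hw)
  have hd0 : ∑' j, d j = 0 := by
    simp only [d, smul_sub]
    rw [(hsm v hv).tsum_sub (hsm w hw)]
    exact sub_eq_zero.mpr hvw
  have hsplit := hds.sum_add_tsum_nat_add (k + 1)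
  rw [hd0, Finset.sum_range_succ, Finset.sum_eq_zero fun j hj => by
    simp [d, hlt j (Finset.mem_range.mp hj)], zero_add] at hsplit
  have htail : ‖∑' m, d (m + (k + 1))‖ ≤ c k / 4 * 2 := by
    refine tsum_of_norm_bounded (hasSum_geometric_two.mul_left (c k / 4)) fun m => ?_
    refine le_trans ?_ (hc k m)
    rw [add_comm m (k + 1)]
    simp only [d, norm_smul, Real.norm_of_nonneg (hpos _).le]
    have h1 := norm_sub_le (v (k + 1 + m)) (w (k + 1 + m))
    have h2 := (hv (k + 1 + m)).2
    have h3 := (hw (k + 1 + m)).2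
    have h4 := hpos (k + 1 + m)
    nlinarith
  have hdk : c k ≤ ‖d k‖ := by
    simp only [d, norm_smul, Real.norm_of_nonneg (hpos _).le]
    exact le_mul_of_one_le_right (hpos k).le (hD (hv k).1 (hw k).1 hk)
  rw [eq_neg_of_add_eq_zero_left hsplit, norm_neg] at hdk
  have := hpos k
  linarith

/-- For a maximal 1-separated set D, both inequalities in |Z| = |D|^ℵ₀ hold: approximating every
multiple n • z from D determines z, and rapidly convergent series encode sequences in D as vectors.
-/
theorem mk_power_aleph0_eq_of_banach (Z : Type u) [NormedAddCommGroup Z] [NormedSpace ℝ Z]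
    [CompleteSpace Z] : #Z ^ (ℵ₀ : Cardinal.{u}) = #Z := by
  classical
  obtain ⟨D, h0, hD, hcov⟩ := exists_maximal_separated Z
  refine le_antisymm ?_ (Cardinal.self_le_power _ Cardinal.one_le_aleph0)
  have hpow : ∀ A : Type u, #(ℕ → A) = #A ^ (ℵ₀ : Cardinal.{u}) := fun A => by simp
  have h1 : #Z ≤ #(ℕ → D) := by
    choose d hdD hd using hcov
    refine Cardinal.mk_le_of_injective (f := fun z n => ⟨d ((n : ℝ) • z), hdD _⟩) ?_
    intro z w hzw
    by_contra hne
    have hpos : 0 < ‖z - w‖ := norm_pos_iff.mpr (sub_ne_zero.mpr hne)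
    obtain ⟨n, hn⟩ := exists_nat_gt (2 / ‖z - w‖)
    rw [div_lt_iff₀ hpos] at hn
    have heq : d ((n : ℝ) • z) = d ((n : ℝ) • w) := congrArg Subtype.val (congrFun hzw n)
    have h2 : ‖(n : ℝ) • (z - w)‖ < 2 := by
      have e : (n : ℝ) • (z - w) = ((n : ℝ) • z - d ((n : ℝ) • z)) -
          ((n : ℝ) • w - d ((n : ℝ) • w)) := by
        rw [heq, smul_sub]
        abel
      rw [e]
      refine (norm_sub_le _ _).trans_lt ?_
      linarith [hd ((n : ℝ) • z), hd ((n : ℝ) • w)]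
    rw [norm_smul, Real.norm_of_nonneg n.cast_nonneg] at h2
    linarith
  have h2 : #(ℕ → D) ≤ #Z := by
    obtain ⟨c, hpos, hsum, hc⟩ := exists_rapidly_decreasing
    -- The term `f i` is placed at every position `Nat.pair i n` with n at least its norm, and 0 ∈ D
    -- elsewhere. This enforces ‖V f k‖ ≤ k and loses no information.
    let V : (ℕ → D) → ℕ → Z := fun f k =>
      if ‖(f k.unpair.1 : Z)‖ ≤ k.unpair.2 then f k.unpair.1 else 0
    have hV : ∀ f k, V f k ∈ D ∧ ‖V f k‖ ≤ k := by
      intro f k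
      by_cases h : ‖(f k.unpair.1 : Z)‖ ≤ k.unpair.2
      · simp only [V, if_pos h]
        exact ⟨(f _).2, h.trans (by exact_mod_cast Nat.unpair_right_le k)⟩
      · simp [V, if_neg h, h0]
    refine Cardinal.mk_le_of_injective (f := fun f => ∑' k, c k • V f k) ?_
    intro f f' hff
    have hVV : V f = V f' := tsum_smul_injOn_separated hD hpos hsum hc (hV f) (hV f') hff
    funext i
    obtain ⟨n, hn⟩ := exists_nat_ge (max ‖(f i : Z)‖ ‖(f' i : Z)‖)
    have h3 := congrFun hVV (Nat.pair i n)
    simp only [V, Nat.unpair_pair, if_pos ((le_max_left _ _).trans hn),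
      if_pos ((le_max_right _ _).trans hn)] at h3
    exact Subtype.ext h3
  have hDZ : #D ^ (ℵ₀ : Cardinal.{u}) = #Z := by rw [← hpow]; exact le_antisymm h2 h1
  calc #Z ^ (ℵ₀ : Cardinal.{u}) = #D ^ (ℵ₀ : Cardinal.{u}) := by
        rw [← hDZ, ← Cardinal.power_mul, Cardinal.aleph0_mul_aleph0]
    _ ≤ #Z := hDZ.le

end BanachCardinality

/-! ### Twisted sums of c₀ pulled back from C(βω) -/

section TwistedSums

/-- The operator 1 − i r kills the kernel of q, hence factors through q; the open mapping theorem
bounds the factor. -/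
theorem IsTwistedSum.exists_section {Y X Z : Type*} [NormedAddCommGroup Y] [NormedSpace ℝ Y]
    [NormedAddCommGroup X] [NormedSpace ℝ X] [CompleteSpace X] [NormedAddCommGroup Z]
    [NormedSpace ℝ Z] [CompleteSpace Z] {i : Y →L[ℝ] X} {q : X →L[ℝ] Z} (h : IsTwistedSum i q)
    {r : X →L[ℝ] Y} (hr : r.comp i = ContinuousLinearMap.id ℝ Y) :
    ∃ s : Z →L[ℝ] X, ∀ z, q (s z) = z := by
  obtain ⟨C, -, hC⟩ := q.exists_preimage_norm_le h.surjective
  choose σ hσ hσC using hC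
  let P : X →L[ℝ] X := ContinuousLinearMap.id ℝ X - i.comp r
  have hP : ∀ x, P x = x - i (r x) := fun x => rfl
  have hri : ∀ y, r (i y) = y := fun y => congrArg (fun f : Y →L[ℝ] Y => f y) hr
  have hPq : ∀ x x', q x = q x' → P x = P x' := by
    intro x x' hxx
    obtain ⟨y, hy⟩ := (h.exact (x - x')).mp (by rw [map_sub, hxx, sub_self])
    have : P (x - x') = 0 := by rw [hP, ← hy, hri, sub_self]
    rwa [map_sub, sub_eq_zero] at this
  let s : Z →ₗ[ℝ] X :=
    { toFun := fun z => P (σ z)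
      map_add' := fun z w => by
        rw [← map_add]
        exact hPq _ _ (by simp [hσ])
      map_smul' := fun a z => by
        rw [RingHom.id_apply, ← map_smul]
        exact hPq _ _ (by simp [hσ]) }
  refine ⟨s.mkContinuous (‖P‖ * C) fun z => ?_, fun z => ?_⟩
  · rw [mul_assoc]
    exact (P.le_opNorm _).trans (mul_le_mul_of_nonneg_left (hσC z) (norm_nonneg _))
  · change q (P (σ z)) = z
    rw [hP, map_sub, h.exact.apply_apply_eq_zero, sub_zero, hσ]

theorem ZeroAtInftyContinuousMap.tendsto_cofinite (c : C₀(ℕ, ℝ)) : Tendsto c cofinite (𝓝 0) := by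
  rw [← cocompact_eq_cofinite]
  exact c.zero_at_infty'

/-- The extension of a null sequence to the Stone–Čech compactification. -/
noncomputable def ZeroAtInftyContinuousMap.extendStoneCech (c : C₀(ℕ, ℝ)) : C(StoneCech ℕ, ℝ) where
  toFun := Function.extend stoneCechUnit c 0
  continuous_toFun := by
    rw [continuous_iff_continuousAt]
    intro p
    by_cases hp : p ∈ range (stoneCechUnit : ℕ → StoneCech ℕ)
    · obtain ⟨n, rfl⟩ := hp
      rw [ContinuousAt, (isOpen_singleton_iff_nhds_eq_pure _).mp (isOpen_singleton_stoneCechUnit n)]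
      exact tendsto_pure_nhds _ _
    · rw [ContinuousAt, Metric.tendsto_nhds]
      intro ε hε
      have hT : {n | ¬ dist (c n) 0 < ε}.Finite :=
        Metric.tendsto_nhds.mp c.tendsto_cofinite ε hε
      -- Only finitely many terms are not small, and a point of the remainder has a neighbourhood
      -- avoiding them.
      have hU : (stoneCechUnit '' {n | ¬ dist (c n) 0 < ε} : Set (StoneCech ℕ))ᶜ ∈ 𝓝 p :=
        (hT.image _).isClosed.isOpen_compl.mem_nhds fun h => hp (image_subset_range _ _ h)
      rw [Function.extend_apply' _ _ _ hp]
      filter_upwards [hU] with x hx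
      by_cases hxr : x ∈ range (stoneCechUnit : ℕ → StoneCech ℕ)
      · obtain ⟨n, rfl⟩ := hxr
        rw [stoneCechUnit_nat_injective.extend_apply]
        by_contra hn
        exact hx (mem_image_of_mem _ hn)
      · rw [Function.extend_apply' _ _ _ hxr]
        simpa using hε

namespace ZeroAtInftyContinuousMap

theorem extendStoneCech_unit (c : C₀(ℕ, ℝ)) (n : ℕ) : c.extendStoneCech (stoneCechUnit n) = c n :=
  stoneCechUnit_nat_injective.extend_apply _ _ _

theorem extendStoneCech_omegaStar (c : C₀(ℕ, ℝ)) (p : OmegaStar) : c.extendStoneCech p.1 = 0 :=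
  Function.extend_apply' _ _ _ p.2

end ZeroAtInftyContinuousMap

theorem ContinuousMap.ext_stoneCech_nat {a b : C(StoneCech ℕ, ℝ)}
    (h : ∀ n, a (stoneCechUnit n) = b (stoneCechUnit n)) : a = b :=
  ContinuousMap.ext fun p => congrFun (denseRange_stoneCechUnit.equalizer a.continuous b.continuous
    (funext h)) p

/-- The functions on the Stone–Čech compactification of `ℕ` that vanish on the remainder are the
extensions of null sequences. -/
theorem ContinuousMap.exists_extendStoneCech_eq {a : C(StoneCech ℕ, ℝ)}
    (ha : ∀ p : OmegaStar, a p.1 = 0) : ∃ c : C₀(ℕ, ℝ), c.extendStoneCech = a := by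
  have h0 : Tendsto (fun n => a (stoneCechUnit n)) cofinite (𝓝 0) := by
    refine Metric.tendsto_nhds.mpr fun ε hε => eventually_cofinite_of_omegaStar fun p => ?_
    have := a.tendsto_comap_stoneCechUnit p.1
    rw [ha p] at this
    exact Metric.tendsto_nhds.mp this ε hε
  let c : C₀(ℕ, ℝ) :=
    { toFun := fun n => a (stoneCechUnit n)
      continuous_toFun := continuous_of_discreteTopology
      zero_at_infty' := by rwa [cocompact_eq_cofinite] }
  exact ⟨c, ContinuousMap.ext_stoneCech_nat fun n => c.extendStoneCech_unit n⟩

variable {Y : Type v} [NormedAddCommGroup Y] [NormedSpace ℝ Y]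

variable (Y) in
/-- The closed unit ball of the dual with the weak-star topology. -/
abbrev WeakDualBall : Type v :=
  ((WeakDual.toStrongDual (𝕜 := ℝ) (E := Y)) ⁻¹' Metric.closedBall 0 1 : Set (WeakDual ℝ Y))

instance compactSpace_weakDualBall : CompactSpace (WeakDualBall Y) :=
  isCompact_iff_compactSpace.mp (WeakDual.isCompact_closedBall 0 1)

theorem continuous_weakDualBall_eval (y : Y) : Continuous fun x : WeakDualBall Y => x.1 y :=
  (WeakDual.eval_continuous y).comp continuous_subtype_val

/-- The middle space of the pullback of `0 ⟶ c₀ ⟶ C(βℕ) ⟶ C(βℕ \ ℕ) ⟶ 0` along the operator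
`y ↦ (p ↦ f p y)`. -/
def pullbackSum (f : C(OmegaStar, WeakDualBall Y)) : Submodule ℝ (Y × C(StoneCech ℕ, ℝ)) where
  carrier := {x | ∀ p : OmegaStar, x.2 p.1 = (f p).1 x.1}
  add_mem' := fun {x y} hx hy p => by simp [hx p, hy p]
  zero_mem' := fun p => by simp
  smul_mem' := fun a x hx p => by simp [hx p]

theorem isClosed_pullbackSum (f : C(OmegaStar, WeakDualBall Y)) :
    IsClosed (pullbackSum f : Set (Y × C(StoneCech ℕ, ℝ))) := by
  have : (pullbackSum f : Set (Y × C(StoneCech ℕ, ℝ))) =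
      ⋂ p : OmegaStar, {x | x.2 p.1 = (f p).1 x.1} := by
    ext x
    simp [pullbackSum]
  rw [this]
  refine isClosed_iInter fun p => isClosed_eq ?_ ?_
  · exact (continuous_eval_const p.1).comp continuous_snd
  · exact (WeakDual.toStrongDual (f p).1).continuous.comp continuous_fst

/-- The inclusion of the null sequences in the pullback. -/
noncomputable def pullbackIncl (f : C(OmegaStar, WeakDualBall Y)) : C₀(ℕ, ℝ) →L[ℝ] pullbackSum f :=
  LinearMap.mkContinuous
    { toFun := fun c => ⟨(0, c.extendStoneCech), fun p => by
        simpa using c.extendStoneCech_omegaStar p⟩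
      map_add' := fun c d => Subtype.ext <| Prod.ext (by simp) <|
        ContinuousMap.ext_stoneCech_nat fun n => by
          simp [ZeroAtInftyContinuousMap.extendStoneCech_unit]
      map_smul' := fun a c => Subtype.ext <| Prod.ext (by simp) <|
        ContinuousMap.ext_stoneCech_nat fun n => by
          simp [ZeroAtInftyContinuousMap.extendStoneCech_unit] }
    1 fun c => by
      rw [one_mul]
      refine max_le (by simp) ((ContinuousMap.norm_le _ (norm_nonneg _)).mpr fun p => ?_)
      by_cases hp : p ∈ range (stoneCechUnit : ℕ → StoneCech ℕ)
      · obtain ⟨n, rfl⟩ := hp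
        change ‖c.extendStoneCech (stoneCechUnit n)‖ ≤ ‖c‖
        rw [c.extendStoneCech_unit]
        exact c.toBCF.norm_coe_le_norm n
      · change ‖c.extendStoneCech p‖ ≤ ‖c‖
        rw [c.extendStoneCech_omegaStar ⟨p, hp⟩, norm_zero]
        exact norm_nonneg c

theorem pullbackIncl_apply (f : C(OmegaStar, WeakDualBall Y)) (c : C₀(ℕ, ℝ)) :
    (pullbackIncl f c : Y × C(StoneCech ℕ, ℝ)) = (0, c.extendStoneCech) :=
  rfl

/-- The quotient map of the pullback. -/
def pullbackProj (f : C(OmegaStar, WeakDualBall Y)) : pullbackSum f →L[ℝ] Y :=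
  (ContinuousLinearMap.fst ℝ Y C(StoneCech ℕ, ℝ)).comp (pullbackSum f).subtypeL

/-- Exactness holds because functions vanishing on ω* are null sequences; surjectivity is Tietze
extension from ω* to βω. -/
theorem isTwistedSum_pullback (f : C(OmegaStar, WeakDualBall Y)) :
    IsTwistedSum (Y := C₀(ℕ, ℝ)) (X := pullbackSum f) (Z := Y) (pullbackIncl f)
      (pullbackProj f) where
  injective := by
    intro c d hcd
    have h : c.extendStoneCech = d.extendStoneCech :=
      congrArg (fun x : pullbackSum f => x.1.2) hcd
    ext n
    rw [← c.extendStoneCech_unit, ← d.extendStoneCech_unit, h]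
  exact := by
    intro x
    refine ⟨fun hx => ?_, ?_⟩
    · have hx0 : x.1.1 = 0 := hx
      obtain ⟨c, hc⟩ := ContinuousMap.exists_extendStoneCech_eq (a := x.1.2) fun p => by
        rw [x.2 p, hx0, map_zero]
      exact ⟨c, Subtype.ext (by rw [pullbackIncl_apply, hc, ← hx0])⟩
    · rintro ⟨c, rfl⟩
      rfl
  surjective := by
    intro y
    let g : C(OmegaStar, ℝ) :=
      ⟨fun p => (f p).1 y, (continuous_weakDualBall_eval y).comp f.continuous⟩
    obtain ⟨a, ha⟩ := ContinuousMap.exists_extension' isClosedEmbedding_omegaStar g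
    exact ⟨⟨(y, a), fun p => congrFun ha p⟩, rfl⟩

theorem ExtVanishes.exists_lift [CompleteSpace Y] (hY : ExtVanishes Y C₀(ℕ, ℝ))
    (f : C(OmegaStar, WeakDualBall Y)) :
    ∃ s : Y →L[ℝ] C(StoneCech ℕ, ℝ), ∀ y (p : OmegaStar), s y p.1 = (f p).1 y := by
  have : CompleteSpace (pullbackSum f) := (isClosed_pullbackSum f).completeSpace_coe
  obtain ⟨r, hr⟩ := hY _ _ _ (isTwistedSum_pullback f)
  obtain ⟨s, hs⟩ := (isTwistedSum_pullback f).exists_section hr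
  refine ⟨(ContinuousLinearMap.snd ℝ Y C(StoneCech ℕ, ℝ)).comp
    ((pullbackSum f).subtypeL.comp s), fun y p => ?_⟩
  have h1 := (s y).2 p
  have h2 : (s y).1.1 = y := hs y
  rw [h2] at h1
  exact h1

/-- A lift to C(βω) is determined by its evaluations at the points of ω, which form a sequence in
Y*, and the lift determines f. -/
theorem ExtVanishes.mk_continuousMap_le [CompleteSpace Y] (hY : ExtVanishes Y C₀(ℕ, ℝ)) :
    #C(OmegaStar, WeakDualBall Y) ≤ #(StrongDual ℝ Y) := by
  choose s hs using hY.exists_lift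
  let N : C(OmegaStar, WeakDualBall Y) → ℕ → StrongDual ℝ Y := fun f n =>
    (ContinuousMap.evalCLM ℝ (stoneCechUnit n)).comp (s f)
  have hN : Function.Injective N := by
    intro f g hfg
    refine ContinuousMap.ext fun p => Subtype.ext (DFunLike.ext _ _ fun y => ?_)
    have h : s f y = s g y := ContinuousMap.ext_stoneCech_nat fun n =>
      congrArg (fun F : ℕ → StrongDual ℝ Y => F n y) hfg
    rw [← hs f, ← hs g, h]
  calc #C(OmegaStar, WeakDualBall Y) ≤ #(ℕ → StrongDual ℝ Y) := Cardinal.mk_le_of_injective hN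
    _ = #(StrongDual ℝ Y) ^ (ℵ₀ : Cardinal.{v}) := by simp
    _ = #(StrongDual ℝ Y) := mk_power_aleph0_eq_of_banach _

/-- Hahn–Banach in the quotient by the closure of M, followed by normalization. -/
theorem exists_weakDualBall_ne_zero {M : Submodule ℝ Y} (hM : M.topologicalClosure ≠ ⊤) :
    ∃ x : WeakDualBall Y, x.1 ≠ 0 ∧ ∀ y ∈ M, x.1 y = 0 := by
  have : IsClosed (M.topologicalClosure : Set Y) := M.isClosed_topologicalClosure
  obtain ⟨y, hy⟩ : ∃ y, y ∉ M.topologicalClosure := by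
    by_contra! h
    exact hM (eq_top_iff.mpr fun y _ => h y)
  have hne : ‖(M.topologicalClosure.mkQ y)‖ ≠ 0 := by
    simpa [norm_eq_zero] using hy
  obtain ⟨g, hg, hgy⟩ := exists_dual_vector ℝ (M.topologicalClosure.mkQ y) hne
  let ξ : StrongDual ℝ Y := g.comp M.topologicalClosure.mkQL
  have hξ : ∀ z, ξ z = g (M.topologicalClosure.mkQ z) := fun z => rfl
  have hξy : ξ y ≠ 0 := by
    rw [hξ, hgy]
    exact_mod_cast hne
  have hnorm : ‖ξ‖ ≠ 0 := fun h => hξy (by rw [norm_eq_zero.mp h]; rfl)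
  refine ⟨⟨StrongDual.toWeakDual (‖ξ‖⁻¹ • ξ), ?_⟩, ?_, ?_⟩
  · rw [mem_preimage, mem_closedBall_zero_iff]
    change ‖‖ξ‖⁻¹ • ξ‖ ≤ 1
    rw [norm_smul, norm_inv, norm_norm, inv_mul_cancel₀ hnorm]
  · intro h
    have h1 : ‖ξ‖⁻¹ * ξ y = 0 := DFunLike.congr_fun h y
    exact mul_ne_zero (inv_ne_zero hnorm) hξy h1
  · intro z hz
    change ‖ξ‖⁻¹ * ξ z = 0
    rw [hξ, Submodule.mkQ_apply, (Submodule.Quotient.mk_eq_zero _).mpr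
      (M.le_topologicalClosure hz), map_zero, mul_zero]

/-- Evaluations at a dense set of size ℵ₁ separate the dual ball. Countably many vectors have a
proper closed span, so some nonzero functional in the ball agrees with 0 on all of them. -/
theorem two_power_aleph_one_le_mk_of_topDensity_eq (hY : topDensity Y = ℵ₁) :
    (2 : Cardinal.{v}) ^ (ℵ₁ : Cardinal.{v}) ≤ #C(OmegaStar, WeakDualBall Y) := by
  obtain ⟨D, hD, hDc⟩ : ∃ D : Set Y, Dense D ∧ #D = ℵ₁ := by
    have h : topDensity Y ∈ _ := csInf_mem ⟨_, univ, dense_univ, rfl⟩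
    rwa [hY] at h
  refine two_power_aleph_one_le_mk_continuousMap hDc
    (fun y => ⟨fun x => x.1 y.1, continuous_weakDualBall_eval y.1⟩) ?_ ?_
  · intro x x' h
    refine Subtype.ext (DFunLike.coe_injective ?_)
    exact Continuous.ext_on hD (WeakDual.toStrongDual x.1).continuous
      (WeakDual.toStrongDual x'.1).continuous fun y hy => h ⟨y, hy⟩
  · intro S hS
    have hsep : TopologicalSpace.IsSeparable
        (closure (Submodule.span ℝ (Subtype.val '' S) : Set Y)) :=
      (hS.image Subtype.val).isSeparable.span.closure
    have hM : (Submodule.span ℝ (Subtype.val '' S : Set Y)).topologicalClosure ≠ ⊤ := by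
      intro h
      rw [← Submodule.topologicalClosure_coe, h, Submodule.top_coe,
        TopologicalSpace.isSeparable_univ_iff] at hsep
      obtain ⟨E, hE, hEd⟩ := TopologicalSpace.exists_countable_dense Y
      have hle : topDensity Y ≤ #E := csInf_le' ⟨E, hEd, rfl⟩
      rw [hY] at hle
      exact (hle.trans hE.le_aleph0).not_gt Cardinal.aleph0_lt_aleph_one
    obtain ⟨x, hx, hxS⟩ := exists_weakDualBall_ne_zero hM
    refine ⟨x, ⟨0, by simp⟩, fun h => hx (congrArg Subtype.val h), fun y hy => ?_⟩
    exact hxS _ (Submodule.subset_span (mem_image_of_mem _ hy))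

end TwistedSums
end

theorem corollary4p6 :
    (∀ (K : Type u) [TopologicalSpace K] [CompactSpace K] [T2Space K],
      topWeight K = ℵ₁ → (2 : Cardinal.{u}) ^ (ℵ₁ : Cardinal.{u}) ≤ Cardinal.mk C(OmegaStar, K)) ∧
    (∀ (Y : Type v) [NormedAddCommGroup Y] [NormedSpace ℝ Y] [CompleteSpace Y],
      topDensity Y = ℵ₁ →
      Cardinal.mk (StrongDual ℝ Y) < (2 : Cardinal.{v}) ^ (ℵ₁ : Cardinal.{v}) →
      ¬ ExtVanishes Y C₀(ℕ, ℝ)) := by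
  refine ⟨fun K _ _ _ hK => two_power_aleph_one_le_of_topWeight_eq hK,
    fun Y _ _ _ hY hlt hExt => ?_⟩
  exact hlt.not_ge
    ((two_power_aleph_one_le_mk_of_topDensity_eq hY).trans hExt.mk_continuousMap_le)
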